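/- **Theorem (revelation principle for untimed private communication equilibrium).** Consider a finite extensive-form game with finitely many players $i$, possibly with chance moves, with perfect recall, a utility function $u_i$ on the set $Z$ of terminal nodes for every player, and nonempty finite action sets. *Decision problems.* Player $i$'s tree-form decision problem has as decision points the infosets $j \in \mathcal J_i$ of player $i$, with action set $A_j$, and as observation points $\Sigma_i = \{\varnothing\} \cup \{ja : j \in \mathcal J_i,\ a \in A_j\}$. Let $\mathcal X_i \subseteq \{0,1\}^{\Sigma_i}$ be the set of sequence-form pure strategies ($x(\sigma) = 1$ iff the player selects every action on the path $\varnothing \to \sigma$). For a profile of (mixed) sequence-form strategies $x_i \in \operatorname{co} \mathcal X_i$, the terminal node $z$ is reached with probability $c(z) \prod_i x_i(\sigma_i(z))$, where $c(z)$ is the product of the chance probabilities on the path to $z$ and $\sigma_i(z)$ is the last observation point of player $i$ on that path; $u_i(x_1,\dots,x_n)$ denotes the resulting expected utility. *Mediators.* For every player $i$ let $S_i$ be an arbitrary set of messages containing $\mathcal J_i \sqcup \Sigma_i \sqcup \{\bot\}$, and let $H_i \in \mathbb N$ be at least the depth of (number of edges from the root to) every decision point of player $i$'s decision problem. A mediator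 of player $i$ is a map $M_i : S_i^{\le H_i} \to S_i$, which gives the reply to each message history (the player's messages and the mediator's replies in chronological order, ending with the player's current message). Let $\mathcal M_i$ be the set of these mediators. *Untimed interactions.* An untimed player $i$, upon reaching a decision point $j$, may send any number of messages (subject to the bound $H_i$ on the length of histories), receiving a reply from the mediator to each, before it plays an action in $A_j$. A pure strategy thus chooses, as a function of $j$ and of the current message history, whether to send a message (and which) or to play an action (and which). A mixed strategy, i.e. a discrete probability distribution over pure strategies, induces the function $\varphi : \mathcal M_i \to \operatorname{co} \mathcal X_i$, where $\varphi(M)(\sigma)$ is the probability that the player plays all the actions on the path to $\sigma$ when interacting with $M$. Let $\Phi_i$ be the set of all functions so induced. *Equilibrium.* An untimed private communication equilibrium is a tuple $(\pi, \varphi_1, \dots, \varphi_n)$ with $\pi$ a discrete probability distribution on $\mathcal M_1 \times \dots \times \mathcal M_n$ and $\varphi_i \in \Phi_i$, such that for every player $i$ and every $\varphi_i' \in \Phi_i$, $$\mathbb E_{(M_1,\dots,M_n) \sim \pi}\bigl[u_i(\varphi_i'(M_i), \varphi_{-i}(M_{-i})) - u_i(\varphi_i(M_i), \varphi_{-i}(M_{-i}))\bigr]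 \le 0 .$$ The direct mediator $M_i^{x}$ of $x \in \mathcal X_i$ replies to a message history $s$ as follows: if $s = (j^{(1)}, a^{(1)}, j^{(2)}, a^{(2)}, \dots, j)$ is the path to a decision point $j$ of player $i$ and $x$ recommends an action $a$ at $j$ (that is, $x(ja) = 1$), it replies $a$; otherwise it replies $\bot$ (an action $a$ at $j$ being sent as the message $ja \in \Sigma_i$). The equilibrium is direct if $\pi$ is supported on profiles of direct mediators and $\varphi_i(M_i^{x}) = x$ for every player $i$ and every $x \in \mathcal X_i$. **Claim.** For every untimed private communication equilibrium $(\pi, \varphi_1, \dots, \varphi_n)$ there is a direct untimed private communication equilibrium $(\pi^*, \varphi_1^*, \dots, \varphi_n^*)$, with the same message sets $S_i$ and bounds $H_i$, that is outcome-equivalent to it: both induce the same probability distribution over the terminal nodes of the game. -/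

import Mathlib

/-! ### Tree-form decision problems -/

/-- A (rooted, tree-form) decision problem. `J` is the set of decision points and `A j` the set of
actions at `j`. The tree is presented through its root paths: `path j` lists, in order, the pairs
(decision point, action taken there) on the path from the root to `j`. Every initial segment of a
root path is again a root path. -/
structure DecisionProblem where
  J : Type*
  A : J → Type*
  finite_action : ∀ j, Finite (A j)
  nonempty_action : ∀ j, Nonempty (A j)
  path : J → List (Σ j, A j)
  path_of_path_eq : ∀ j l m, path j = l ++ [m] → path m.1 = l

namespace DecisionProblem

/-- Observation points (sequences): `none` is the root `∅`, and `some ⟨j, a⟩` is the point `ja`. -/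
abbrev Seq (D : DecisionProblem) := Option (Σ j, D.A j)

/-- The moves on the path from the root to an observation point. -/
def seqPath (D : DecisionProblem) : D.Seq → List (Σ j, D.A j)
  | none => []
  | some m => D.path m.1 ++ [m]

/-- The depth (number of edges below the root) of a decision point: each earlier decision point on
its path is followed by an observation point, and the root is an observation point. -/
def depth (D : DecisionProblem) (j : D.J) : ℕ := 2 * (D.path j).length + 1

open Classical in
/-- The sequence-form vector of a choice `s` of one action at every decision point. -/
noncomputable def seqForm (D : DecisionProblem) (s : ∀ j, D.A j) : D.Seq → ℝ :=
  fun σ => if ∀ m ∈ D.seqPath σ, s m.1 = m.2 then 1 else 0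

/-- The set `X` of sequence-form pure strategies. -/
def pureStrategies (D : DecisionProblem) : Set (D.Seq → ℝ) := Set.range D.seqForm

end DecisionProblem

/-! ### Expectations under discrete distributions -/

/-- The expectation of a real function under a discrete probability distribution. -/
noncomputable def pmfExpect {α : Type*} (p : PMF α) (f : α → ℝ) : ℝ := ∑' a, (p a).toReal * f a

/-! ### Mediators and untimed interaction with a mediator -/

/-- A mediator with message set `S` and horizon `H`: it answers every message history (messages of
the player and earlier replies in chronological order, the last entry being the player's current
message) of length at most `H`. -/
abbrev Mediator (S : Type*) (H : ℕ) := {s : List S // s.length ≤ H} → S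

/-- A pure strategy of a player who may send any number of messages upon reaching a decision point.
At the real decision point `j`, with current message history `h` (messages and replies), the player
either plays an action at `j`, or sends a further message, as long as the horizon permits. -/
def UntimedStrategy (D : DecisionProblem) (S : Type*) (H : ℕ) :=
  ∀ (j : D.J) (h : List S), D.A j ⊕ {_m : S // h.length < H}

namespace UntimedStrategy

variable {D : DecisionProblem} {S : Type*} {H : ℕ}

/-- What happens at decision point `j` when it is reached with message history `h`: the action
finally played, and the message history at that time. -/
def act (f : UntimedStrategy D S H) (M : Mediator S H) (j : D.J) (h : List S) :
    D.A j × List S :=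
  match f j h with
  | Sum.inl a => (a, h)
  | Sum.inr ⟨m, hm⟩ =>
      f.act M j ((h ++ [m]) ++ [M ⟨h ++ [m], by simp; omega⟩])
termination_by H - h.length
decreasing_by simp; omega

/-- Starting with message history `h`, the player plays all the actions in the given list of moves,
when the corresponding decision points are reached one after the other. -/
def Plays (f : UntimedStrategy D S H) (M : Mediator S H) :
    List (Σ j, D.A j) → List S → Prop
  | [], _ => True
  | m :: l, h => (f.act M m.1 h).1 = m.2 ∧ f.Plays M l (f.act M m.1 h).2

end UntimedStrategy

open Classical in
/-- The function from mediators to (mixed) sequence-form strategies induced by a mixed strategy of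
the untimed player: its value at `M` and `σ` is the probability that the player plays all actions on
the path to `σ` when it interacts with `M`. -/
noncomputable def untimedMap (D : DecisionProblem) {S : Type*} {H : ℕ}
    (μ : PMF (UntimedStrategy D S H)) (M : Mediator S H) : D.Seq → ℝ :=
  fun σ => pmfExpect μ fun f => if f.Plays M (D.seqPath σ) [] then 1 else 0

/-- The set `Φ` of untimed interactions, as functions of the mediator. -/
def untimedInteractions (D : DecisionProblem) (S : Type*) (H : ℕ) :
    Set (Mediator S H → D.Seq → ℝ) :=
  Set.range (untimedMap D)

namespace DecisionProblem

variable (D : DecisionProblem) {S : Type*}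

/-- The basic messages: decision points, observation points, and the empty message `⊥`. -/
abbrev BasicMessage := D.J ⊕ D.Seq ⊕ Unit

/-- The message history `(j₁, a₁, j₂, a₂, …, j)` along the path to decision point `j`; the action
`aₖ` at `jₖ` is represented by the observation point `jₖaₖ`. -/
def pathMessages (e : D.BasicMessage ↪ S) (j : D.J) : List S :=
  (D.path j).flatMap (fun m => [e (Sum.inl m.1), e (Sum.inr (Sum.inl (some m)))]) ++
    [e (Sum.inl j)]

open Classical in
/-- The direct mediator of a pure strategy `x`: if the message history is the path to a decision
point `j` and `x` recommends an action `a` at `j` (that is, `x(ja) = 1`), the reply is that action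
(represented by `ja`); otherwise the reply is `⊥`. -/
noncomputable def directMediator (e : D.BasicMessage ↪ S) (H : ℕ) (x : D.Seq → ℝ) :
    Mediator S H := fun s =>
  if h : ∃ m : Σ j, D.A j, s.1 = D.pathMessages e m.1 ∧ x (some m) = 1 then
    e (Sum.inr (Sum.inl (some h.choose)))
  else e (Sum.inr (Sum.inr ()))

end DecisionProblem

/-! ### Extensive-form games -/

/-- Finite game trees with players `ι`, infoset labels `I i` for player `i`, and actions `A i j` at
infoset `j` of player `i`. A nonterminal node is either a chance node with a distribution over its
children, or belongs to an infoset of some player, and has one child for each action there. -/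
inductive GameTree {ι : Type*} (I : ι → Type*) (A : ∀ i, I i → Type*) where
  | leaf : GameTree I A
  | chance (n : ℕ) (p : PMF (Fin n)) (child : Fin n → GameTree I A) : GameTree I A
  | decision (i : ι) (j : I i) (child : A i j → GameTree I A) : GameTree I A

section Moves

variable {ι : Type*} {I : ι → Type*} {A : ∀ i, I i → Type*}

open Classical in
/-- The moves of player `i` in a list of moves of all players. -/
noncomputable def ownMoves (i : ι) (l : List (Σ i, Σ j : I i, A i j)) : List (Σ j : I i, A i j) :=
  l.filterMap fun m => if h : m.1 = i then some (h ▸ m.2) else none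

end Moves

namespace GameTree

universe u v w

variable {ι : Type u} {I : ι → Type v} {A : ∀ i, I i → Type w}

/-- `T.Reaches l T'`: there is a node of `T` with subtree `T'` such that the moves of the players
on the way from the root to this node are `l`. -/
inductive Reaches : GameTree I A → List (Σ i, Σ j : I i, A i j) → GameTree I A → Prop
  | refl (T : GameTree I A) : Reaches T [] T
  | chance {n : ℕ} {p : PMF (Fin n)} {child : Fin n → GameTree I A} {l : List _}
      {T : GameTree I A} (k : Fin n) (h : Reaches (child k) l T) :
      Reaches (GameTree.chance n p child) l T
  | decision {i : ι} {j : I i} {child : A i j → GameTree I A} {l : List _}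
      {T : GameTree I A} (a : A i j) (h : Reaches (child a) l T) :
      Reaches (GameTree.decision i j child) (⟨i, j, a⟩ :: l) T

/-- The terminal nodes of a game tree. -/
def Terminal : GameTree I A → Type w
  | leaf => PUnit
  | chance n _ child => Σ k : Fin n, (child k).Terminal
  | decision i j child => Σ a : A i j, (child a).Terminal

/-- The moves of the players on the path to a terminal node. -/
def moves : (T : GameTree I A) → T.Terminal → List (Σ i, Σ j : I i, A i j)
  | leaf, _ => []
  | chance _ _ child, z => (child z.1).moves z.2
  | decision i j child, z => ⟨i, j, z.1⟩ :: (child z.1).moves z.2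

/-- The product of the probabilities of the chance moves on the path to a terminal node. -/
noncomputable def chanceProb : (T : GameTree I A) → T.Terminal → ℝ
  | leaf, _ => 1
  | chance _ p child, z => (p z.1).toReal * (child z.1).chanceProb z.2
  | decision _ _ child, z => (child z.1).chanceProb z.2

theorem finite_terminal (hA : ∀ i j, Finite (A i j)) : (T : GameTree I A) → Finite T.Terminal
  | leaf => inferInstanceAs (Finite PUnit)
  | chance n _ child =>
      have : ∀ k, Finite (child k).Terminal := fun k => finite_terminal hA (child k)
      inferInstanceAs (Finite (Σ k : Fin n, (child k).Terminal))
  | decision i j child =>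
      have := hA i j
      have : ∀ a, Finite (child a).Terminal := fun a => finite_terminal hA (child a)
      inferInstanceAs (Finite (Σ a : A i j, (child a).Terminal))

/-- Every move of a player on the way to a node was made at an earlier node. -/
theorem Reaches.exists_of_ownMoves {T T' : GameTree I A} {L : List (Σ i, Σ j : I i, A i j)}
    (h : T.Reaches L T') (i : ι) :
    ∀ (l : List (Σ j : I i, A i j)) (m : Σ j : I i, A i j), ownMoves i L = l ++ [m] →
      ∃ L' child, T.Reaches L' (GameTree.decision i m.1 child) ∧ ownMoves i L' = l := by
  induction h with
  | refl T => intro l m hl; simp [ownMoves] at hl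
  | chance k _ ih =>
    intro l m hl
    obtain ⟨L', child, h1, h2⟩ := ih l m hl
    exact ⟨L', child, .chance k h1, h2⟩
  | @decision i' j child L T a _ ih =>
    intro l m hl
    by_cases hi : i' = i
    · subst hi
      have hc : ∀ L', ownMoves i' (⟨i', j, a⟩ :: L') = ⟨j, a⟩ :: ownMoves i' L' := by
        intro L'; simp [ownMoves]
      rw [hc] at hl
      cases l with
      | nil =>
        simp only [List.nil_append, List.cons.injEq] at hl
        obtain ⟨rfl, _⟩ := hl
        exact ⟨[], child, .refl _, by simp [ownMoves]⟩
      | cons m' l' =>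
        simp only [List.cons_append, List.cons.injEq] at hl
        obtain ⟨L', ch, h1, h2⟩ := ih l' m hl.2
        exact ⟨_, ch, .decision a h1, by rw [hc, h2, hl.1]⟩
    · have hc : ∀ L', ownMoves i (⟨i', j, a⟩ :: L') = ownMoves i L' := by
        intro L'; simp [ownMoves, hi]
      rw [hc] at hl
      obtain ⟨L', ch, h1, h2⟩ := ih l m hl
      exact ⟨_, ch, .decision a h1, by rw [hc, h2]⟩

end GameTree

/-- A finite extensive-form game with perfect recall and set of players `ι`. -/
structure ExtensiveFormGame (ι : Type*) where
  Infoset : ι → Type*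
  Act : ∀ i, Infoset i → Type*
  finite_act : ∀ i j, Finite (Act i j)
  nonempty_act : ∀ i j, Nonempty (Act i j)
  tree : GameTree Infoset Act
  utility : ι → tree.Terminal → ℝ
  /-- Every infoset contains a node. -/
  infoset_nonempty : ∀ i j, ∃ l child, tree.Reaches l (GameTree.decision i j child)
  /-- Perfect recall: a player has the same own past (infosets visited and actions taken there) at
  all nodes of an infoset. -/
  perfect_recall : ∀ i j l child l' child',
    tree.Reaches l (GameTree.decision i j child) →
    tree.Reaches l' (GameTree.decision i j child') → ownMoves i l = ownMoves i l'

namespace ExtensiveFormGame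

variable {ι : Type*} (G : ExtensiveFormGame ι)

/-- The terminal nodes of the game. -/
abbrev Terminal := G.tree.Terminal

noncomputable instance : Fintype G.Terminal :=
  have := GameTree.finite_terminal G.finite_act G.tree
  Fintype.ofFinite _

/-- The tree-form decision problem faced by player `i`: its decision points are the infosets, and
the path to an infoset consists of the player's own moves on the way to any node of it. -/
noncomputable def decisionProblem (i : ι) : DecisionProblem where
  J := G.Infoset i
  A := G.Act i
  finite_action := G.finite_act i
  nonempty_action := G.nonempty_act i
  path j := ownMoves i (G.infoset_nonempty i j).choose
  path_of_path_eq := by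
    intro j l m hl
    obtain ⟨_, h⟩ := (G.infoset_nonempty i j).choose_spec
    obtain ⟨L', child, h1, h2⟩ := h.exists_of_ownMoves i l m hl
    obtain ⟨_, h'⟩ := (G.infoset_nonempty i m.1).choose_spec
    exact (G.perfect_recall i m.1 _ _ _ _ h' h1).trans h2

/-- The last observation point of player `i` on the path to a terminal node. -/
noncomputable def lastSeq (i : ι) (z : G.Terminal) : (G.decisionProblem i).Seq :=
  (ownMoves i (G.tree.moves z)).getLast?

variable [Fintype ι]

/-- The probability of reaching a terminal node under a profile of sequence-form strategies. -/
noncomputable def reachProb (x : ∀ i, (G.decisionProblem i).Seq → ℝ) (z : G.Terminal) : ℝ :=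
  G.tree.chanceProb z * ∏ i, x i (G.lastSeq i z)

/-- The expected utility of player `i` under a profile of sequence-form strategies. -/
noncomputable def expUtility (i : ι) (x : ∀ i, (G.decisionProblem i).Seq → ℝ) : ℝ :=
  ∑ z, G.reachProb x z * G.utility i z

variable {S : ι → Type*} {H : ι → ℕ}

/-- The distribution over terminal nodes when mediators `M` are drawn from `π` and the players
use `φ i (M i)`. -/
noncomputable def outcome (π : PMF (∀ i, Mediator (S i) (H i)))
    (φ : ∀ i, Mediator (S i) (H i) → (G.decisionProblem i).Seq → ℝ) (z : G.Terminal) : ℝ :=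
  pmfExpect π fun M => G.reachProb (fun i => φ i (M i)) z

open Classical in
/-- `(π, φ)` is an untimed private communication equilibrium: every `φ i` is an untimed interaction,
and no player can profit by switching to another untimed interaction. -/
def IsUntimedEquilibrium (π : PMF (∀ i, Mediator (S i) (H i)))
    (φ : ∀ i, Mediator (S i) (H i) → (G.decisionProblem i).Seq → ℝ) : Prop :=
  (∀ i, φ i ∈ untimedInteractions (G.decisionProblem i) (S i) (H i)) ∧
  ∀ i, ∀ φ' ∈ untimedInteractions (G.decisionProblem i) (S i) (H i),
    pmfExpect π (fun M => G.expUtility i (fun k => Function.update φ i φ' k (M k)) -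
      G.expUtility i (fun k => φ k (M k))) ≤ 0

/-- `(π, φ)` is direct: `π` is a distribution over profiles of direct mediators, and `φ i` maps the
direct mediator of each pure strategy `x` to `x`. -/
def IsDirect (e : ∀ i, (G.decisionProblem i).BasicMessage ↪ S i)
    (π : PMF (∀ i, Mediator (S i) (H i)))
    (φ : ∀ i, Mediator (S i) (H i) → (G.decisionProblem i).Seq → ℝ) : Prop :=
  (∀ M ∈ π.support, ∀ i, ∃ x ∈ (G.decisionProblem i).pureStrategies,
    M i = (G.decisionProblem i).directMediator (e i) (H i) x) ∧
  ∀ i, ∀ x ∈ (G.decisionProblem i).pureStrategies,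
    φ i ((G.decisionProblem i).directMediator (e i) (H i) x) = x

end ExtensiveFormGame

/-! Draw `M` from `π` and, independently, a pure strategy `f i` from each player's mixture. Let `f
i` play against `M i` in advance, and give player `i` the direct mediator of the resulting pure
strategy (`inducedMediator`). Against these mediators, honest reporting and obedience
(`UntimedStrategy.direct`) reproduce the old outcome: reach probabilities are products over the
players and the `f i` are independent (`outcome_directDistribution`).

A deviation `f'` against the induced mediator can be carried out against `M` itself by a player who
also draws `f` and answers the messages of `f'` internally. While these messages follow a path, the
reply is the action of `f` at the reported infoset, found by letting `f` continue its talk with `M`.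
After the first departure a direct mediator only replies `⊥`, so `f` is never needed again. Hence a
single run of `f` against `M` suffices, and the real history stays within the horizon because it is
a history of `f`. Being untimed matters here: `f'` may report infosets other than the current one,
and `f` must then talk to `M` as if it were there.

A strategy sees only its infoset and the message history, so the simulator recovers its internal
state by replaying a `Dialogue`. The pure case is `simulate_playOf`, the mixed case
`exists_untimedMap_eq`. Gains depend only on outcomes (`pmfExpect_expUtility_sub`), so each
deviation from the direct profile gains exactly what some deviation from the old equilibrium gains.
-/

/-! ### Expectations and independent products of discrete distributions -/

section Expectation

variable {α β : Type*}

theorem PMF.summable_toReal (p : PMF α) : Summable fun a => (p a).toReal :=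
  ENNReal.summable_toReal p.tsum_coe_ne_top

theorem PMF.tsum_toReal (p : PMF α) : ∑' a, (p a).toReal = 1 := by
  rw [← ENNReal.tsum_toReal_eq p.apply_ne_top, p.tsum_coe, ENNReal.toReal_one]

theorem summable_toReal_mul (p : PMF α) {f : α → ℝ} {C : ℝ} (hf : ∀ a, |f a| ≤ C) :
    Summable fun a => (p a).toReal * f a := by
  refine Summable.of_norm_bounded (p.summable_toReal.mul_right C) fun a => ?_
  rw [norm_mul, Real.norm_of_nonneg ENNReal.toReal_nonneg, Real.norm_eq_abs]
  exact mul_le_mul_of_nonneg_left (hf a) ENNReal.toReal_nonneg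

theorem abs_pmfExpect_le (p : PMF α) {f : α → ℝ} {C : ℝ} (hf : ∀ a, |f a| ≤ C) :
    |pmfExpect p f| ≤ C := by
  have h : ‖∑' a, (p a).toReal * f a‖ ≤ ∑' a, (p a).toReal * C :=
    tsum_of_norm_bounded (p.summable_toReal.mul_right C).hasSum fun a => by
      rw [norm_mul, Real.norm_of_nonneg ENNReal.toReal_nonneg, Real.norm_eq_abs]
      exact mul_le_mul_of_nonneg_left (hf a) ENNReal.toReal_nonneg
  rwa [tsum_mul_right, p.tsum_toReal, one_mul, Real.norm_eq_abs] at h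

theorem pmfExpect_mul_left (p : PMF α) (c : ℝ) (f : α → ℝ) :
    pmfExpect p (fun a => c * f a) = c * pmfExpect p f := by
  simp only [pmfExpect, ← tsum_mul_left]
  exact tsum_congr fun a => by ring

theorem pmfExpect_sub (p : PMF α) {f g : α → ℝ} {C : ℝ} (hf : ∀ a, |f a| ≤ C)
    (hg : ∀ a, |g a| ≤ C) :
    pmfExpect p (fun a => f a - g a) = pmfExpect p f - pmfExpect p g := by
  simp only [pmfExpect, mul_sub]
  exact (summable_toReal_mul p hf).tsum_sub (summable_toReal_mul p hg)

theorem pmfExpect_sum (p : PMF α) (s : Finset β) {f : β → α → ℝ} {C : ℝ}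
    (hf : ∀ b a, |f b a| ≤ C) :
    pmfExpect p (fun a => ∑ b ∈ s, f b a) = ∑ b ∈ s, pmfExpect p (f b) := by
  simp only [pmfExpect, Finset.mul_sum]
  exact Summable.tsum_finsetSum fun b _ => summable_toReal_mul p (hf b)

theorem pmfExpect_pure (a : α) (f : α → ℝ) : pmfExpect (PMF.pure a) f = f a := by
  classical
  rw [pmfExpect, tsum_eq_single a]
  · simp
  · intro b hb
    simp [hb]

theorem pmfExpect_bind (p : PMF α) (q : α → PMF β) {f : β → ℝ} {C : ℝ} (hf : ∀ b, |f b| ≤ C) :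
    pmfExpect (p.bind q) f = pmfExpect p fun a => pmfExpect (q a) f := by
  -- Absolute summability over pairs, by comparison with the constant `C`, justifies exchanging the
  -- two sums.
  have hsum : Summable (Function.uncurry fun (a : α) (b : β) =>
      (p a).toReal * ((q a b).toReal * f b)) := by
    have hC : 0 ≤ C := by
      obtain ⟨a, _⟩ := p.support_nonempty
      obtain ⟨b, _⟩ := (q a).support_nonempty
      exact (abs_nonneg _).trans (hf b)
    refine Summable.of_norm_bounded (g := fun x : α × β =>
      (p x.1).toReal * ((q x.1 x.2).toReal * C)) ?_ ?_
    · have h0 : 0 ≤ fun x : α × β => (p x.1).toReal * ((q x.1 x.2).toReal * C) := fun x =>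
        mul_nonneg ENNReal.toReal_nonneg (mul_nonneg ENNReal.toReal_nonneg hC)
      rw [summable_prod_of_nonneg h0]
      refine ⟨fun a => ?_, ?_⟩
      · have h1 := ((q a).summable_toReal.mul_right C).mul_left (p a).toReal
        exact h1
      simp only [tsum_mul_left, tsum_mul_right, PMF.tsum_toReal]
      exact p.summable_toReal.mul_right _
    · rintro ⟨a, b⟩
      simp only [Function.uncurry, norm_mul, Real.norm_of_nonneg ENNReal.toReal_nonneg,
        Real.norm_eq_abs]
      exact mul_le_mul_of_nonneg_left (mul_le_mul_of_nonneg_left (hf b) ENNReal.toReal_nonneg)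
        ENNReal.toReal_nonneg
  have hb : ∀ b, ((p.bind q) b).toReal * f b = ∑' a, (p a).toReal * ((q a b).toReal * f b) := by
    intro b
    rw [PMF.bind_apply, ENNReal.tsum_toReal_eq fun a =>
      ENNReal.mul_ne_top (p.apply_ne_top a) ((q a).apply_ne_top b), ← tsum_mul_right]
    exact tsum_congr fun a => by rw [ENNReal.toReal_mul, mul_assoc]
  simp only [pmfExpect, hb, ← tsum_mul_left]
  exact hsum.tsum_comm

theorem pmfExpect_map (p : PMF α) (g : α → β) {f : β → ℝ} {C : ℝ} (hf : ∀ b, |f b| ≤ C) :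
    pmfExpect (p.map g) f = pmfExpect p fun a => f (g a) := by
  rw [← PMF.bind_pure_comp, pmfExpect_bind p _ hf]
  simp only [Function.comp_apply, pmfExpect_pure]

end Expectation

theorem abs_prod_le_one {ι : Type*} (s : Finset ι) {x : ι → ℝ} (hx : ∀ i, |x i| ≤ 1) :
    |∏ i ∈ s, x i| ≤ 1 := by
  rw [Finset.abs_prod]
  exact Finset.prod_le_one (fun i _ => abs_nonneg _) fun i _ => hx i

/-- Product distributions over finitely many factors: the coordinates are independent. -/
theorem exists_pmf_expect_prod {ι : Type*} [Fintype ι] {α : ι → Type*} (μ : ∀ i, PMF (α i)) :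
    ∃ P : PMF (∀ i, α i), ∀ g : ∀ i, α i → ℝ, (∀ i a, |g i a| ≤ 1) →
      pmfExpect P (fun f => ∏ i, g i (f i)) = ∏ i, pmfExpect (μ i) (g i) := by
  classical
  suffices h : ∀ s : Finset ι, ∃ P : PMF (∀ i, α i), ∀ g : ∀ i, α i → ℝ, (∀ i a, |g i a| ≤ 1) →
      pmfExpect P (fun f => ∏ i ∈ s, g i (f i)) = ∏ i ∈ s, pmfExpect (μ i) (g i) from
    h Finset.univ
  intro s
  induction s using Finset.induction_on with
  | empty =>
    exact ⟨PMF.pure fun i => (μ i).support_nonempty.some, fun g _ => by simp [pmfExpect_pure]⟩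
  | insert i s hi ih =>
    obtain ⟨P, hP⟩ := ih
    -- Coordinate `i` is redrawn from `μ i`; the factors over `s` do not see the change.
    refine ⟨P.bind fun f => (μ i).map (Function.update f i), fun g hg => ?_⟩
    have hb : ∀ f : ∀ i, α i, |∏ k ∈ insert i s, g k (f k)| ≤ 1 := fun f =>
      abs_prod_le_one _ fun k => hg k _
    have hu : ∀ (f : ∀ i, α i) (a : α i), ∏ k ∈ insert i s, g k (Function.update f i a k) =
        (∏ k ∈ s, g k (f k)) * g i a := by
      intro f a
      rw [Finset.prod_insert hi, Function.update_self, mul_comm]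
      congr 1
      refine Finset.prod_congr rfl fun k hk => ?_
      rw [Function.update_of_ne (ne_of_mem_of_not_mem hk hi)]
    rw [pmfExpect_bind _ _ hb]
    simp only [pmfExpect_map (μ i) _ hb, hu, pmfExpect_mul_left]
    rw [Finset.prod_insert hi, ← hP g hg, ← pmfExpect_mul_left]
    exact congrArg _ (funext fun f => mul_comm _ _)

/-! ### Dialogues and their replay -/

/-- A dialogue: a program that sends messages, reads the replies and finally returns a value. -/
inductive Dialogue (S : Type*) (α : Type*) where
  | ret : α → Dialogue S α
  | send : S → (S → Dialogue S α) → Dialogue S α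

namespace Dialogue

variable {S α β : Type*}

def bind : Dialogue S α → (α → Dialogue S β) → Dialogue S β
  | ret a, Q => Q a
  | send m k, Q => send m fun r => (k r).bind Q

/-- The result, and the final message history, when the replies are given by `O`. -/
def run (O : List S → S) : Dialogue S α → List S → α × List S
  | ret a, h => (a, h)
  | send m k, h => (k (O (h ++ [m]))).run O ((h ++ [m]) ++ [O (h ++ [m])])

/-- The next message, or the returned value, after a given message history. -/
def next : Dialogue S α → List S → S ⊕ α
  | ret a, _ => Sum.inr a
  -- Only replies steer the replay; the recorded message is skipped without being checked.
  | send _ k, _ :: r :: h => (k r).next h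
  | send m _, _ => Sum.inl m

theorem run_bind (O : List S → S) (P : Dialogue S α) (Q : α → Dialogue S β) (h : List S) :
    (P.bind Q).run O h = (Q (P.run O h).1).run O (P.run O h).2 := by
  induction P generalizing h with
  | ret a => rfl
  | send m k ih => exact ih _ _

/-- The transcript `t` of `P` is fixed before the continuation `Q` is chosen, and replaying `t`
consumes exactly `P`. The start `h₀` is arbitrary because the replies depend on the whole history,
whereas `next` sees only the dialogue's own part. -/
theorem exists_next_bind (O : List S → S) (P : Dialogue S α) (h₀ : List S) :
    ∃ t, (P.run O h₀).2 = h₀ ++ t ∧ ∀ (Q : α → Dialogue S β) (h : List S),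
      (P.bind Q).next (t ++ h) = (Q (P.run O h₀).1).next h := by
  induction P generalizing h₀ with
  | ret a => exact ⟨[], by simp [run], fun Q h => by simp [bind, run]⟩
  | send m k ih =>
    obtain ⟨t, ht, hn⟩ := ih (O (h₀ ++ [m])) ((h₀ ++ [m]) ++ [O (h₀ ++ [m])])
    refine ⟨m :: O (h₀ ++ [m]) :: t, by rw [run, ht]; simp, fun Q h => ?_⟩
    exact hn Q h

theorem next_bind_run (O : List S → S) (P : Dialogue S α) (Q : α → Dialogue S β) (h : List S) :
    (P.bind Q).next ((P.run O []).2 ++ h) = (Q (P.run O []).1).next h := by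
  obtain ⟨t, ht, hn⟩ := P.exists_next_bind (β := β) O []
  rw [ht, List.nil_append, hn]

end Dialogue

/-- A mediator as a function of all message histories, long ones being truncated. -/
def Mediator.extend {S : Type*} {H : ℕ} (M : Mediator S H) (s : List S) : S :=
  M ⟨s.take H, by simp⟩

theorem Mediator.extend_of_le {S : Type*} {H : ℕ} (M : Mediator S H) {s : List S}
    (hs : s.length ≤ H) : Mediator.extend M s = M ⟨s, hs⟩ := by
  simp only [Mediator.extend, List.take_of_length_le hs]

/-! ### Paths, message histories and direct mediators -/

namespace DecisionProblem

variable {D : DecisionProblem}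

/-- Every move of the list is made at a decision point whose path is the preceding part. -/
def IsPath (D : DecisionProblem) (l : List (Σ j, D.A j)) : Prop :=
  ∀ l₁ m l₂, l = l₁ ++ m :: l₂ → D.path m.1 = l₁

theorem isPath_append_singleton {l : List (Σ j, D.A j)} {m : Σ j, D.A j}
    (h : D.IsPath (l ++ [m])) : D.IsPath l ∧ D.path m.1 = l :=
  ⟨fun l₁ m' l₂ hl => h l₁ m' (l₂ ++ [m]) (by simp [hl]), h l m [] rfl⟩

theorem isPath_path (j : D.J) : D.IsPath (D.path j) := by
  suffices h : ∀ (l₂ l₁ : List (Σ j, D.A j)) (m : Σ j, D.A j) (j : D.J),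
      D.path j = l₁ ++ m :: l₂ → D.path m.1 = l₁ from fun l₁ m l₂ hl => h l₂ l₁ m j hl
  intro l₂
  induction l₂ using List.reverseRecOn with
  | nil => intro l₁ m j hj; exact D.path_of_path_eq j l₁ m hj
  | append_singleton l₂ m' ih =>
    intro l₁ m j hj
    exact ih l₁ m m'.1 (D.path_of_path_eq j _ m' (by simp [hj]))

theorem isPath_seqPath (σ : D.Seq) : D.IsPath (D.seqPath σ) := by
  cases σ with
  | none => intro l₁ m l₂ h; simp [seqPath] at h
  | some m =>
    intro l₁ m' l₂ h
    simp only [seqPath] at h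
    rcases List.eq_nil_or_concat l₂ with rfl | ⟨l, a, rfl⟩
    · obtain ⟨h1, h2⟩ := List.append_inj' h rfl
      simp only [List.cons.injEq, and_true] at h2
      rw [← h2, h1]
    · have h' : D.path m.1 ++ [m] = (l₁ ++ m' :: l) ++ [a] := by simpa using h
      exact isPath_path m.1 l₁ m' l (List.append_inj' h' rfl).1

/-- Sequence forms ignore choices at points that the strategy itself excludes. Going down the path,
each point is reached by `s` once the earlier moves agree, so the hypothesis applies there. -/
theorem IsPath.forall_iff {l : List (Σ j, D.A j)} (hl : D.IsPath l) {p s : ∀ j, D.A j}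
    (h : ∀ j, (∀ m ∈ D.path j, s m.1 = m.2) → p j = s j) :
    (∀ m ∈ l, p m.1 = m.2) ↔ ∀ m ∈ l, s m.1 = m.2 := by
  induction l using List.reverseRecOn with
  | nil => simp
  | append_singleton l m ih =>
    obtain ⟨h1, h2⟩ := isPath_append_singleton hl
    simp only [List.mem_append, List.mem_singleton, or_imp, forall_and, forall_eq, ih h1]
    refine and_congr_right fun hs => ?_
    rw [h m.1 (by rwa [h2])]

variable {S : Type*} (e : D.BasicMessage ↪ S)

/-- The messages exchanged along a list of moves. -/
def moveMessages (l : List (Σ j, D.A j)) : List S :=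
  l.flatMap fun m => [e (Sum.inl m.1), e (Sum.inr (Sum.inl (some m)))]

theorem pathMessages_eq (j : D.J) :
    D.pathMessages e j = moveMessages e (D.path j) ++ [e (Sum.inl j)] := rfl

theorem moveMessages_append_singleton (l : List (Σ j, D.A j)) (m : Σ j, D.A j) :
    moveMessages e (l ++ [m]) =
      (moveMessages e l ++ [e (Sum.inl m.1)]) ++ [e (Sum.inr (Sum.inl (some m)))] := by
  simp [moveMessages]

theorem length_moveMessages (l : List (Σ j, D.A j)) :
    (moveMessages e l).length = 2 * l.length := by
  simp [moveMessages, mul_comm]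

theorem moveMessages_injective : Function.Injective (moveMessages e) := by
  intro l
  induction l with
  | nil => intro l' h; cases l' with
    | nil => rfl
    | cons m l' => simp [moveMessages] at h
  | cons m l ih => intro l' h; cases l' with
    | nil => simp [moveMessages] at h
    | cons m' l' =>
      simp only [moveMessages, List.flatMap_cons, List.cons_append, List.nil_append,
        List.cons.injEq, EmbeddingLike.apply_eq_iff_eq, Sum.inr.injEq, Sum.inl.injEq,
        Option.some.injEq] at h
      rw [h.2.1, ih h.2.2]

theorem pathMessages_injective : Function.Injective (D.pathMessages e) := by
  intro j j' h
  have := (List.append_inj' h rfl).2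
  simpa using this

theorem seqForm_some_eq_one {s : ∀ j, D.A j} {m : Σ j, D.A j} :
    D.seqForm s (some m) = 1 ↔ (∀ m' ∈ D.path m.1, s m'.1 = m'.2) ∧ s m.1 = m.2 := by
  classical
  rw [seqForm, ite_eq_left_iff]
  simp [seqPath, or_imp, forall_and]

theorem directMediator_pathMessages {H : ℕ} (s : ∀ j, D.A j) (j : D.J)
    (hs : ∀ m ∈ D.path j, s m.1 = m.2) (hH : (D.pathMessages e j).length ≤ H) :
    D.directMediator e H (D.seqForm s) ⟨D.pathMessages e j, hH⟩ =
      e (Sum.inr (Sum.inl (some ⟨j, s j⟩))) := by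
  have hex : ∃ m : Σ j, D.A j, D.pathMessages e j = D.pathMessages e m.1 ∧
      D.seqForm s (some m) = 1 := ⟨⟨j, s j⟩, rfl, seqForm_some_eq_one.2 ⟨hs, rfl⟩⟩
  -- The mediator's arbitrary choice is forced: the last message determines the infoset, and a pure
  -- strategy recommends only one action there.
  have huniq : ∀ m : Σ j, D.A j, D.pathMessages e j = D.pathMessages e m.1 ∧
      D.seqForm s (some m) = 1 → m = ⟨j, s j⟩ := by
    rintro ⟨j', a⟩ ⟨h1, h2⟩
    obtain rfl : j = j' := pathMessages_injective e h1
    obtain rfl : s j = a := (seqForm_some_eq_one.1 h2).2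
    rfl
  rw [directMediator, dif_pos hex]
  congr 3
  rw [huniq _ hex.choose_spec]

theorem directMediator_of_forall_ne {H : ℕ} (x : D.Seq → ℝ) (h : {s : List S // s.length ≤ H})
    (hh : ∀ j, h.1 ≠ D.pathMessages e j) :
    D.directMediator e H x h = e (Sum.inr (Sum.inr ())) := by
  rw [directMediator, dif_neg]
  rintro ⟨m, hm, _⟩
  exact hh _ hm

end DecisionProblem

/-! ### Untimed play as a choice of actions -/

namespace UntimedStrategy

open DecisionProblem

variable {D : DecisionProblem} {S : Type*} {H : ℕ}

theorem act_of_inl {f : UntimedStrategy D S H} {j : D.J} {h : List S} {a : D.A j}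
    (hf : f j h = Sum.inl a) (M : Mediator S H) : f.act M j h = (a, h) := by
  rw [act, hf]

theorem act_of_inr {f : UntimedStrategy D S H} {j : D.J} {h : List S} {m : S}
    {hm : h.length < H} (hf : f j h = Sum.inr ⟨m, hm⟩) (M : Mediator S H) :
    f.act M j h = f.act M j ((h ++ [m]) ++ [M ⟨h ++ [m], by simp; omega⟩]) := by
  rw [act, hf]

/-- Message histories are bounded by the horizon (rounded up to a full exchange). -/
theorem length_act_le (f : UntimedStrategy D S H) (M : Mediator S H) (j : D.J) (h : List S)
    (hh : h.length ≤ H + 1) : (f.act M j h).2.length ≤ H + 1 := by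
  match hf : f j h with
  | Sum.inl a => rw [act_of_inl hf]; exact hh
  | Sum.inr ⟨m, hm⟩ =>
    rw [act_of_inr hf]
    exact f.length_act_le M j _ (by simp; omega)
termination_by H - h.length
decreasing_by simp; omega

/-- The message history after the decision points of the given moves. -/
def history (f : UntimedStrategy D S H) (M : Mediator S H) (l : List (Σ j, D.A j))
    (h : List S) : List S :=
  l.foldl (fun h m => (f.act M m.1 h).2) h

theorem history_append_singleton (f : UntimedStrategy D S H) (M : Mediator S H)
    (l : List (Σ j, D.A j)) (m : Σ j, D.A j) (h : List S) :
    f.history M (l ++ [m]) h = (f.act M m.1 (f.history M l h)).2 := by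
  simp [history]

/-- The action played at each decision point if it is reached. -/
def playOf (f : UntimedStrategy D S H) (M : Mediator S H) (j : D.J) : D.A j :=
  (f.act M j (f.history M (D.path j) [])).1

theorem plays_iff (f : UntimedStrategy D S H) (M : Mediator S H) (l : List (Σ j, D.A j))
    (h : List S) : f.Plays M l h ↔
      ∀ l₁ m l₂, l = l₁ ++ m :: l₂ → (f.act M m.1 (f.history M l₁ h)).1 = m.2 := by
  induction l generalizing h with
  | nil => simp [Plays]
  | cons m l ih =>
    rw [Plays, ih]
    constructor
    · rintro ⟨h1, h2⟩ l₁ m' l₂ hl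
      cases l₁ with
      | nil =>
        simp only [List.nil_append, List.cons.injEq] at hl
        rw [← hl.1]; exact h1
      | cons m'' l₁ =>
        simp only [List.cons_append, List.cons.injEq] at hl
        rw [← hl.1]
        exact h2 l₁ m' l₂ hl.2
    · intro hl
      exact ⟨hl [] m l rfl, fun l₁ m' l₂ h' => hl (m :: l₁) m' l₂ (by simp [h'])⟩

/-- `Plays` threads the history through the list, while `playOf` recomputes it from the root. On a
path, the moves before a point are its root path, so both histories coincide. -/
theorem plays_iff_of_isPath (f : UntimedStrategy D S H) (M : Mediator S H)
    {l : List (Σ j, D.A j)} (hl : D.IsPath l) :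
    f.Plays M l [] ↔ ∀ m ∈ l, f.playOf M m.1 = m.2 := by
  rw [plays_iff]
  constructor
  · intro h m hm
    obtain ⟨l₁, l₂, rfl⟩ := List.append_of_mem hm
    rw [playOf, hl l₁ m l₂ rfl]
    exact h l₁ m l₂ rfl
  · intro h l₁ m l₂ hl'
    rw [← hl l₁ m l₂ hl']
    exact h m (by simp [hl'])

open Classical in
theorem seqForm_playOf (f : UntimedStrategy D S H) (M : Mediator S H) (σ : D.Seq) :
    D.seqForm (f.playOf M) σ = if f.Plays M (D.seqPath σ) [] then 1 else 0 := by
  rw [seqForm]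
  exact if_congr (f.plays_iff_of_isPath M (isPath_seqPath σ)).symm rfl rfl

/-! ### The direct strategy -/

open Classical in
/-- The strategy that reports the decision point and plays the action that is recommended. -/
noncomputable def direct (e : D.BasicMessage ↪ S) (H : ℕ) : UntimedStrategy D S H := fun j h =>
  if ha : ∃ a : D.A j, h = moveMessages e (D.path j ++ [⟨j, a⟩]) then Sum.inl ha.choose
  else if hH : h.length < H then Sum.inr ⟨e (Sum.inl j), hH⟩
  -- Arbitrary default; in honest play against the direct mediator of a pure strategy it is not
  -- needed when the depths are at most `H`.
  else Sum.inl (D.nonempty_action j).some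

theorem direct_act (e : D.BasicMessage ↪ S) (s : ∀ j, D.A j) (j : D.J) (hH : D.depth j ≤ H)
    (hs : ∀ m ∈ D.path j, s m.1 = m.2) :
    (direct e H).act (D.directMediator e H (D.seqForm s)) j (moveMessages e (D.path j)) =
      (s j, moveMessages e (D.path j ++ [⟨j, s j⟩])) := by
  have hlen : (moveMessages e (D.path j)).length < H := by
    rw [length_moveMessages]; rw [depth] at hH; omega
  have h1 : direct e H j (moveMessages e (D.path j)) = Sum.inr ⟨e (Sum.inl j), hlen⟩ := by
    rw [direct, dif_neg, dif_pos hlen]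
    rintro ⟨a, ha⟩
    have := congrArg List.length (moveMessages_injective e ha)
    simp at this
  have h2 : direct e H j (moveMessages e (D.path j ++ [⟨j, s j⟩])) = Sum.inl (s j) := by
    have hex : ∃ a : D.A j, moveMessages e (D.path j ++ [⟨j, s j⟩]) =
        moveMessages e (D.path j ++ [⟨j, a⟩]) := ⟨s j, rfl⟩
    rw [direct, dif_pos hex]
    have := moveMessages_injective e hex.choose_spec
    simp only [List.append_cancel_left_eq, List.cons.injEq, Sigma.mk.injEq, heq_eq_eq, true_and,
      and_true] at this
    rw [← this]
  rw [act_of_inr h1]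
  have h3 := directMediator_pathMessages e s j hs (H := H) (by rw [pathMessages_eq]; simp; omega)
  simp only [pathMessages_eq] at h3
  rw [h3, ← moveMessages_append_singleton e (D.path j) ⟨j, s j⟩, act_of_inl h2]

theorem direct_playOf (e : D.BasicMessage ↪ S) (hH : ∀ j, D.depth j ≤ H) (s : ∀ j, D.A j)
    (j : D.J) (hs : ∀ m ∈ D.path j, s m.1 = m.2) :
    (direct e H).playOf (D.directMediator e H (D.seqForm s)) j = s j := by
  have key : ∀ l, D.IsPath l → (∀ m ∈ l, s m.1 = m.2) →
      (direct e H).history (D.directMediator e H (D.seqForm s)) l [] = moveMessages e l := by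
    intro l
    induction l using List.reverseRecOn with
    | nil => intros; rfl
    | append_singleton l m ih =>
      intro hl hsl
      obtain ⟨h1, h2⟩ := isPath_append_singleton hl
      have h3 : ∀ m ∈ l, s m.1 = m.2 := fun m' hm => hsl m' (by simp [hm])
      rw [history_append_singleton, ih h1 h3]
      subst h2
      rw [direct_act e s m.1 (hH _) h3, hsl m (by simp)]
  rw [playOf, key _ (isPath_path j) hs, direct_act e s j (hH j) hs]

/-- Obedience agrees with `s` at the points that `s` reaches, which is all that the sequence form
records. -/
theorem seqForm_direct_playOf (e : D.BasicMessage ↪ S) (hH : ∀ j, D.depth j ≤ H)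
    (s : ∀ j, D.A j) :
    D.seqForm ((direct e H).playOf (D.directMediator e H (D.seqForm s))) = D.seqForm s := by
  classical
  funext σ
  exact if_congr ((isPath_seqPath σ).forall_iff (direct_playOf e hH s)) rfl rfl

/-! ### Strategies that carry out a dialogue -/

open Classical in
/-- The strategy that replays the dialogue of the current decision point. -/
noncomputable def ofDialogue (P : ∀ j, Dialogue S (D.A j)) : UntimedStrategy D S H := fun j h =>
  match (P j).next h with
  | Sum.inr a => Sum.inl a
  | Sum.inl m =>
    if hl : h.length < H then Sum.inr ⟨m, hl⟩ else Sum.inl (D.nonempty_action j).some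

end UntimedStrategy

namespace UntimedStrategy

open DecisionProblem

variable {D : DecisionProblem} {S : Type*} {H : ℕ}

theorem _root_.Dialogue.length_le_length_run {α : Type*} (O : List S → S) (P : Dialogue S α)
    (h : List S) : h.length ≤ (P.run O h).2.length := by
  induction P generalizing h with
  | ret a => exact le_rfl
  | send m k ih =>
    refine le_trans ?_ (ih (O (h ++ [m])) ((h ++ [m]) ++ [O (h ++ [m])]))
    simp only [List.length_append]; omega

/-- `Q` is what remains of the dialogue at `j` after `h₀`, so the induction runs over `Q`. The
length bound keeps the default action of `ofDialogue` out of play. -/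
theorem ofDialogue_act (P : ∀ j, Dialogue S (D.A j)) (M : Mediator S H) (j : D.J)
    (Q : Dialogue S (D.A j)) (h₀ : List S) (hQ : ∀ h, (P j).next (h₀ ++ h) = Q.next h)
    (hlen : (Q.run (Mediator.extend M) h₀).2.length ≤ H + 1) :
    (ofDialogue (H := H) P).act M j h₀ = Q.run (Mediator.extend M) h₀ := by
  induction Q generalizing h₀ with
  | ret a =>
    have h1 : (P j).next h₀ = Sum.inr a := by simpa [Dialogue.next] using hQ []
    exact act_of_inl (by rw [ofDialogue, h1]) M
  | send m k ih =>
    have h1 : (P j).next h₀ = Sum.inl m := by simpa [Dialogue.next] using hQ []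
    rw [Dialogue.run] at hlen ⊢
    -- A message and its reply add two entries, so a final length of at most `H + 1` leaves room to
    -- send here.
    have hl : h₀.length < H := by
      have := (Dialogue.length_le_length_run _ _ _).trans hlen
      simp at this; omega
    have h2 : ofDialogue (H := H) P j h₀ = Sum.inr ⟨m, hl⟩ := by
      rw [ofDialogue, h1]
      exact dif_pos hl
    have hl' : (h₀ ++ [m]).length ≤ H := by simp; omega
    rw [act_of_inr h2 M]
    rw [Mediator.extend_of_le M hl'] at hlen ⊢
    refine ih _ _ (fun h => ?_) hlen
    have := hQ (m :: M ⟨h₀ ++ [m], hl'⟩ :: h)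
    simpa [Dialogue.next] using this

/-! ### Simulating a deviation against the original mediator -/

/-- The dialogue of a strategy at a decision point. -/
def toDialogue (f : UntimedStrategy D S H) (j : D.J) (h : List S) :
    Dialogue S (D.A j × List S) :=
  match f j h with
  | Sum.inl a => Dialogue.ret (a, h)
  | Sum.inr ⟨m, _⟩ => Dialogue.send m fun r => f.toDialogue j ((h ++ [m]) ++ [r])
termination_by H - h.length
decreasing_by simp; omega

theorem run_toDialogue (f : UntimedStrategy D S H) (M : Mediator S H) (j : D.J) (h : List S) :
    (f.toDialogue j h).run (Mediator.extend M) h = (f.act M j h, (f.act M j h).2) := by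
  match hf : f j h with
  | Sum.inl a => rw [toDialogue, act_of_inl hf, hf]; rfl
  | Sum.inr ⟨m, hm⟩ =>
    have hl : (h ++ [m]).length ≤ H := by simp; omega
    rw [toDialogue, act_of_inr hf, hf, Dialogue.run, Mediator.extend_of_le M hl]
    exact f.run_toDialogue M j _
termination_by H - h.length
decreasing_by simp; omega

variable (e : D.BasicMessage ↪ S)

open Classical in
/-- The dialogue in which the strategy `f'` talks to a simulated direct mediator: the messages of
`f'` that continue a path are answered by the action that `f` plays there, all others by `⊥`. The
state is the message history of `f'` and the history of the actual interaction. -/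
noncomputable def simulateAct (f f' : UntimedStrategy D S H) (j : D.J) (h' h : List S) :
    Dialogue S (D.A j × List S × List S) :=
  match f' j h' with
  | Sum.inl a => Dialogue.ret (a, h', h)
  | Sum.inr ⟨m, _⟩ =>
    if hj : ∃ k, h' ++ [m] = D.pathMessages e k then
      (f.toDialogue hj.choose h).bind fun r =>
        f.simulateAct f' j ((h' ++ [m]) ++ [e (Sum.inr (Sum.inl (some ⟨hj.choose, r.1⟩)))]) r.2
    else f.simulateAct f' j ((h' ++ [m]) ++ [e (Sum.inr (Sum.inr ()))]) h
termination_by H - h'.length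
decreasing_by all_goals (simp; omega)

/-- The simulated and the actual history fit together. -/
def Consistent (f : UntimedStrategy D S H) (M : Mediator S H) (h' h : List S) : Prop :=
  h.length ≤ H + 1 ∧ ∀ l, D.IsPath l → h' = moveMessages e l →
    h = f.history M l [] ∧ ∀ m ∈ l, f.playOf M m.1 = m.2

/-- The direct mediator of the pure strategy that results from playing `f` against `M`. -/
noncomputable def inducedMediator (f : UntimedStrategy D S H) (M : Mediator S H) :
    Mediator S H :=
  D.directMediator e H (D.seqForm (f.playOf M))

/-- The invariant constrains the real history only while the simulated one is an honest path, which
is exactly when `f` may have to be consulted again. -/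
theorem run_simulateAct (f f' : UntimedStrategy D S H) (M : Mediator S H) (j : D.J)
    (h' h : List S) (hc : f.Consistent e M h' h) :
    ∃ h₁, (f.simulateAct e f' j h' h).run (Mediator.extend M) h =
      (((f'.act (f.inducedMediator e M) j h').1, (f'.act (f.inducedMediator e M) j h').2, h₁),
        h₁) ∧ f.Consistent e M (f'.act (f.inducedMediator e M) j h').2 h₁ := by
  match hf : f' j h' with
  | Sum.inl a =>
    rw [simulateAct, act_of_inl hf, hf]
    exact ⟨h, rfl, hc⟩
  | Sum.inr ⟨m, hm⟩ =>
    have hl : (h' ++ [m]).length ≤ H := by simp; omega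
    rw [simulateAct, act_of_inr hf, hf]
    by_cases hj : ∃ k, h' ++ [m] = D.pathMessages e k
    · simp only [dif_pos hj]
      have hk := hj.choose_spec
      generalize hj.choose = k at hk ⊢
      -- Stripping the last report shows that the simulated history is the honest one along the path
      -- to `k`; the invariant then gives that `f` reaches `k` with real history `h`.
      obtain ⟨hh', hm'⟩ := List.append_inj' hk rfl
      obtain ⟨hh, hs⟩ := hc.2 _ (isPath_path k) hh'
      have hrep : f.inducedMediator e M ⟨h' ++ [m], hl⟩ =
          e (Sum.inr (Sum.inl (some ⟨k, f.playOf M k⟩))) := by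
        have := directMediator_pathMessages e (f.playOf M) k hs (H := H) (by rwa [← hk])
        simp only [← hk] at this
        exact this
      have hact : (f.act M k h).1 = f.playOf M k := by rw [hh]; rfl
      rw [hrep, Dialogue.run_bind, run_toDialogue, hact]
      refine f.run_simulateAct f' M j _ _ ⟨f.length_act_le M k h hc.1, fun l hl' heq => ?_⟩
      have heq' : moveMessages e (D.path k ++ [⟨k, f.playOf M k⟩]) = moveMessages e l := by
        rw [moveMessages_append_singleton, ← heq, hk, pathMessages_eq]
      obtain rfl := moveMessages_injective e heq'
      refine ⟨by rw [history_append_singleton, ← hh], ?_⟩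
      simp only [List.mem_append, List.mem_singleton, or_imp, forall_and, forall_eq, and_true]
      exact hs
    · simp only [dif_neg hj]
      have hrep : f.inducedMediator e M ⟨h' ++ [m], hl⟩ = e (Sum.inr (Sum.inr ())) :=
        directMediator_of_forall_ne e _ _ fun k hk => hj ⟨k, hk⟩
      rw [hrep]
      refine f.run_simulateAct f' M j _ _ ⟨hc.1, fun l hl' heq => ?_⟩
      -- After a `⊥` the invariant is vacuous: an honest nonempty history ends with an observation
      -- point.
      rcases List.eq_nil_or_concat l with rfl | ⟨l, a, rfl⟩
      · simp [moveMessages] at heq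
      · rw [List.concat_eq_append, moveMessages_append_singleton] at heq
        simpa using (List.append_inj' heq rfl).2
termination_by H - h'.length
decreasing_by all_goals (simp; omega)

/-- The simulation along a list of moves, starting from empty histories. -/
noncomputable def simulatePath (f f' : UntimedStrategy D S H) (l : List (Σ j, D.A j)) :
    Dialogue S (List S × List S) :=
  l.foldl (fun P m => P.bind fun st => (f.simulateAct e f' m.1 st.1 st.2).bind fun r =>
    Dialogue.ret r.2) (Dialogue.ret ([], []))

/-- The strategy that plays like `f'` against the direct mediator induced by `f`. -/
noncomputable def simulate (f f' : UntimedStrategy D S H) : UntimedStrategy D S H :=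
  ofDialogue fun j => (f.simulatePath e f' (D.path j)).bind fun st =>
    (f.simulateAct e f' j st.1 st.2).bind fun r => Dialogue.ret r.1

/-- The real history `h` is the transcript of the simulation before `j`, so replaying it restores
the state `(h', h)` and leaves only the dialogue at `j`. -/
theorem simulate_act (f f' : UntimedStrategy D S H) (M : Mediator S H) (j : D.J)
    (h' h : List S) (hc : f.Consistent e M h' h)
    (hrun : (f.simulatePath e f' (D.path j)).run (Mediator.extend M) [] = ((h', h), h)) :
    ((f.simulate e f').act M j h).1 = (f'.act (f.inducedMediator e M) j h').1 ∧
      (f.simulateAct e f' j h' h).run (Mediator.extend M) h =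
        (((f'.act (f.inducedMediator e M) j h').1, (f'.act (f.inducedMediator e M) j h').2,
          ((f.simulate e f').act M j h).2), ((f.simulate e f').act M j h).2) ∧
      f.Consistent e M (f'.act (f.inducedMediator e M) j h').2
        ((f.simulate e f').act M j h).2 := by
  obtain ⟨h₁, hr, hc₁⟩ := f.run_simulateAct e f' M j h' h hc
  have hQ : ((f.simulateAct e f' j h' h).bind fun r => Dialogue.ret r.1).run
      (Mediator.extend M) h = ((f'.act (f.inducedMediator e M) j h').1, h₁) := by
    rw [Dialogue.run_bind, hr]; rfl
  have hact : (f.simulate e f').act M j h = ((f'.act (f.inducedMediator e M) j h').1, h₁) := by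
    rw [← hQ]
    refine ofDialogue_act _ M j _ h (fun t => ?_) (by rw [hQ]; exact hc₁.1)
    have := Dialogue.next_bind_run (Mediator.extend M) (f.simulatePath e f' (D.path j))
      (fun st => (f.simulateAct e f' j st.1 st.2).bind fun r => Dialogue.ret r.1) t
    rwa [hrun] at this
  rw [hact]
  exact ⟨rfl, hr, hc₁⟩

theorem run_simulatePath (f f' : UntimedStrategy D S H) (M : Mediator S H)
    (l : List (Σ j, D.A j)) (hl : D.IsPath l) :
    (f.simulatePath e f' l).run (Mediator.extend M) [] =
      ((f'.history (f.inducedMediator e M) l [], (f.simulate e f').history M l []),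
        (f.simulate e f').history M l []) ∧
    f.Consistent e M (f'.history (f.inducedMediator e M) l [])
      ((f.simulate e f').history M l []) := by
  induction l using List.reverseRecOn with
  | nil =>
    refine ⟨rfl, by simp [history], fun l _ h => ?_⟩
    obtain rfl : [] = l := moveMessages_injective e h
    simp [history]
  | append_singleton l m ih =>
    obtain ⟨h1, h2⟩ := isPath_append_singleton hl
    obtain ⟨hr, hc⟩ := ih h1
    obtain ⟨-, h4, h5⟩ := f.simulate_act e f' M m.1 _ _ hc (by rw [h2]; exact hr)
    rw [history_append_singleton, history_append_singleton]
    refine ⟨?_, h5⟩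
    rw [simulatePath, List.foldl_append, List.foldl_cons, List.foldl_nil, Dialogue.run_bind,
      ← simulatePath, hr, Dialogue.run_bind, h4]
    rfl

theorem simulate_playOf (f f' : UntimedStrategy D S H) (M : Mediator S H) :
    (f.simulate e f').playOf M = f'.playOf (f.inducedMediator e M) := by
  funext j
  obtain ⟨hr, hc⟩ := f.run_simulatePath e f' M (D.path j) (isPath_path j)
  exact (f.simulate_act e f' M j _ _ hc hr).1

end UntimedStrategy

/-! ### Mixed strategies -/

theorem DecisionProblem.abs_seqForm_le_one (D : DecisionProblem) (s : ∀ j, D.A j) (σ : D.Seq) :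
    |D.seqForm s σ| ≤ 1 := by
  rw [DecisionProblem.seqForm]
  split_ifs <;> simp

section UntimedMap

variable {D : DecisionProblem} {S : Type*} {H : ℕ}

theorem untimedMap_apply (μ : PMF (UntimedStrategy D S H)) (M : Mediator S H) (σ : D.Seq) :
    untimedMap D μ M σ = pmfExpect μ fun f => D.seqForm (f.playOf M) σ := by
  simp only [UntimedStrategy.seqForm_playOf]
  rfl

theorem abs_untimedMap_le_one (μ : PMF (UntimedStrategy D S H)) (M : Mediator S H) (σ : D.Seq) :
    |untimedMap D μ M σ| ≤ 1 := by
  rw [untimedMap_apply]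
  exact abs_pmfExpect_le μ fun f => D.abs_seqForm_le_one _ σ

theorem untimedMap_direct (e : D.BasicMessage ↪ S) (hH : ∀ j, D.depth j ≤ H) (s : ∀ j, D.A j) :
    untimedMap D (PMF.pure (UntimedStrategy.direct e H)) (D.directMediator e H (D.seqForm s)) =
      D.seqForm s := by
  funext σ
  rw [untimedMap_apply, pmfExpect_pure, UntimedStrategy.seqForm_direct_playOf e hH]

/-- Every deviation against the induced direct mediators is an interaction with the original
mediators. -/
theorem exists_untimedMap_eq (e : D.BasicMessage ↪ S) (μ μ' : PMF (UntimedStrategy D S H)) :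
    ∃ ν : PMF (UntimedStrategy D S H), ∀ M σ, untimedMap D ν M σ =
      pmfExpect μ fun f => untimedMap D μ' (f.inducedMediator e M) σ := by
  -- The deviator draws `f` and `f'` independently at the start and plays the simulation.
  refine ⟨μ.bind fun f => μ'.map fun f' => f.simulate e f', fun M σ => ?_⟩
  have hb : ∀ f : UntimedStrategy D S H, |D.seqForm (f.playOf M) σ| ≤ 1 := fun f =>
    D.abs_seqForm_le_one _ σ
  rw [untimedMap_apply, pmfExpect_bind _ _ hb]
  simp only [pmfExpect_map μ' _ hb, UntimedStrategy.simulate_playOf, untimedMap_apply]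

end UntimedMap

/-! ### Outcomes, utilities and the equilibrium condition -/

theorem GameTree.abs_chanceProb_le_one {ι : Type*} {I : ι → Type*} {A : ∀ i, I i → Type*} :
    (T : GameTree I A) → ∀ z : T.Terminal, |T.chanceProb z| ≤ 1
  | leaf, _ => by simp [chanceProb]
  | chance _ p child, z => by
    rw [chanceProb, abs_mul, abs_of_nonneg ENNReal.toReal_nonneg]
    exact mul_le_one₀ (ENNReal.toReal_le_of_le_ofReal zero_le_one (by simpa using p.coe_le_one _))
      (abs_nonneg _) (abs_chanceProb_le_one (child z.1) z.2)
  | decision _ _ child, z => by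
    rw [chanceProb]
    exact abs_chanceProb_le_one (child z.1) z.2

namespace ExtensiveFormGame

variable {ι : Type*} (G : ExtensiveFormGame ι) [Fintype ι] {S : ι → Type*} {H : ι → ℕ}

theorem abs_reachProb_le_one {x : ∀ i, (G.decisionProblem i).Seq → ℝ} (hx : ∀ i σ, |x i σ| ≤ 1)
    (z : G.Terminal) : |G.reachProb x z| ≤ 1 := by
  rw [reachProb, abs_mul]
  exact mul_le_one₀ (G.tree.abs_chanceProb_le_one z) (abs_nonneg _)
    (abs_prod_le_one _ fun i => hx i _)

/-- Expected utility is a finite linear combination of reach probabilities, so the expectation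
passes inside the sum. -/
theorem pmfExpect_expUtility_sub (π : PMF (∀ i, Mediator (S i) (H i))) (i : ι)
    {φ φ' : ∀ i, Mediator (S i) (H i) → (G.decisionProblem i).Seq → ℝ}
    (hφ : ∀ i M σ, |φ i M σ| ≤ 1) (hφ' : ∀ i M σ, |φ' i M σ| ≤ 1) :
    pmfExpect π (fun M => G.expUtility i (fun k => φ k (M k)) -
      G.expUtility i (fun k => φ' k (M k))) =
      ∑ z, G.utility i z * (G.outcome π φ z - G.outcome π φ' z) := by
  have key : ∀ M : ∀ i, Mediator (S i) (H i), G.expUtility i (fun k => φ k (M k)) -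
      G.expUtility i (fun k => φ' k (M k)) = ∑ z, G.utility i z *
        (G.reachProb (fun k => φ k (M k)) z - G.reachProb (fun k => φ' k (M k)) z) := by
    intro M
    rw [expUtility, expUtility, ← Finset.sum_sub_distrib]
    exact Finset.sum_congr rfl fun z _ => by ring
  have h1 : ∀ z (M : ∀ i, Mediator (S i) (H i)), |G.reachProb (fun k => φ k (M k)) z| ≤ 1 :=
    fun z M => G.abs_reachProb_le_one (fun k σ => hφ k _ σ) z
  have h2 : ∀ z (M : ∀ i, Mediator (S i) (H i)), |G.reachProb (fun k => φ' k (M k)) z| ≤ 1 :=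
    fun z M => G.abs_reachProb_le_one (fun k σ => hφ' k _ σ) z
  simp only [key]
  rw [pmfExpect_sum π Finset.univ (C := (∑ z, |G.utility i z|) * 2)
    (f := fun z M => G.utility i z *
      (G.reachProb (fun k => φ k (M k)) z - G.reachProb (fun k => φ' k (M k)) z))]
  · refine Finset.sum_congr rfl fun z _ => ?_
    rw [pmfExpect_mul_left, pmfExpect_sub π (h1 z) (h2 z)]
    rfl
  · intro z M
    rw [abs_mul]
    refine mul_le_mul (Finset.single_le_sum (f := fun z => |G.utility i z|)
      (fun _ _ => abs_nonneg _) (Finset.mem_univ z)) ?_ (abs_nonneg _)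
      (Finset.sum_nonneg fun _ _ => abs_nonneg _)
    calc _ ≤ _ := abs_sub _ _
      _ ≤ 1 + 1 := add_le_add (h1 z M) (h2 z M)
      _ = 2 := by norm_num

/-- Mediators drawn from `π`, then replaced by the direct mediators of pure strategies that the
players using `f` drawn from `P` would end up playing. -/
noncomputable def directDistribution (e : ∀ i, (G.decisionProblem i).BasicMessage ↪ S i)
    (π : PMF (∀ i, Mediator (S i) (H i)))
    (P : PMF (∀ i, UntimedStrategy (G.decisionProblem i) (S i) (H i))) :
    PMF (∀ i, Mediator (S i) (H i)) :=
  π.bind fun M => P.map fun f i => (f i).inducedMediator (e i) (M i)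

/-- For fixed `M` the reach probability is a product of functions of the independent `f i`, so its
expectation factors. The families are general so that both obedience and a unilateral deviation are
covered. -/
theorem outcome_directDistribution (e : ∀ i, (G.decisionProblem i).BasicMessage ↪ S i)
    (π : PMF (∀ i, Mediator (S i) (H i)))
    {μ : ∀ i, PMF (UntimedStrategy (G.decisionProblem i) (S i) (H i))}
    {P : PMF (∀ i, UntimedStrategy (G.decisionProblem i) (S i) (H i))}
    (hP : ∀ g : ∀ i, UntimedStrategy (G.decisionProblem i) (S i) (H i) → ℝ,
      (∀ i a, |g i a| ≤ 1) →
        pmfExpect P (fun f => ∏ i, g i (f i)) = ∏ i, pmfExpect (μ i) (g i))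
    {φ ψ : ∀ i, Mediator (S i) (H i) → (G.decisionProblem i).Seq → ℝ}
    (hφ : ∀ i M σ, |φ i M σ| ≤ 1)
    (hψ : ∀ i M σ, ψ i M σ =
      pmfExpect (μ i) fun f => φ i (f.inducedMediator (e i) M) σ) (z : G.Terminal) :
    G.outcome (G.directDistribution e π P) φ z = G.outcome π ψ z := by
  have h1 : ∀ M : ∀ i, Mediator (S i) (H i), |G.reachProb (fun k => φ k (M k)) z| ≤ 1 :=
    fun M => G.abs_reachProb_le_one (fun k σ => hφ k _ σ) z
  rw [outcome, directDistribution, pmfExpect_bind _ _ h1, outcome]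
  refine congrArg _ (funext fun M => ?_)
  rw [pmfExpect_map _ _ h1]
  simp only [reachProb, pmfExpect_mul_left, hψ]
  rw [← hP (fun i f => φ i (f.inducedMediator (e i) (M i)) (G.lastSeq i z)) fun i f => hφ i _ _]

end ExtensiveFormGame

theorem mainTheorem3 {ι : Type*} [Fintype ι] (G : ExtensiveFormGame ι)
    (S : ι → Type*) (H : ι → ℕ)
    (e : ∀ i, (G.decisionProblem i).BasicMessage ↪ S i)
    (hH : ∀ i j, (G.decisionProblem i).depth j ≤ H i)
    (π : PMF (∀ i, Mediator (S i) (H i)))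
    (φ : ∀ i, Mediator (S i) (H i) → (G.decisionProblem i).Seq → ℝ)
    (hπ : G.IsUntimedEquilibrium π φ) :
    ∃ (π' : PMF (∀ i, Mediator (S i) (H i)))
      (φ' : ∀ i, Mediator (S i) (H i) → (G.decisionProblem i).Seq → ℝ),
      G.IsUntimedEquilibrium π' φ' ∧ G.IsDirect e π' φ' ∧
        ∀ z, G.outcome π' φ' z = G.outcome π φ z := by
  classical
  obtain ⟨hφ, heq⟩ := hπ
  choose μ hμ using hφ
  obtain rfl : (fun i => untimedMap (G.decisionProblem i) (μ i)) = φ := funext hμ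
  obtain ⟨P, hP⟩ := exists_pmf_expect_prod μ
  set δ : ∀ i, Mediator (S i) (H i) → (G.decisionProblem i).Seq → ℝ := fun i =>
    untimedMap _ (PMF.pure (UntimedStrategy.direct (e i) (H i))) with hδ
  have hδb : ∀ i M σ, |δ i M σ| ≤ 1 := fun i M σ => abs_untimedMap_le_one _ M σ
  have hφb : ∀ i M σ, |untimedMap (G.decisionProblem i) (μ i) M σ| ≤ 1 := fun i M σ =>
    abs_untimedMap_le_one _ M σ
  -- Obeying the induced mediator of `f` yields the pure play of `f` against `M`; averaging over `μ
  -- i` gives back the original interaction.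
  have hδμ : ∀ i M σ, untimedMap (G.decisionProblem i) (μ i) M σ =
      pmfExpect (μ i) fun f => δ i (f.inducedMediator (e i) M) σ := by
    intro i M σ
    simp only [hδ, UntimedStrategy.inducedMediator, untimedMap_direct (e i) (hH i)]
    exact untimedMap_apply _ M σ
  have hout := fun z => G.outcome_directDistribution e π hP hδb hδμ z
  refine ⟨G.directDistribution e π P, δ, ⟨fun i => ⟨_, rfl⟩, ?_⟩, ⟨?_, ?_⟩, hout⟩
  · rintro i _ ⟨μ', rfl⟩
    obtain ⟨ν, hν⟩ := exists_untimedMap_eq (e i) (μ i) μ'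
    have hub : ∀ (φ : ∀ i, Mediator (S i) (H i) → (G.decisionProblem i).Seq → ℝ)
        (κ : PMF (UntimedStrategy (G.decisionProblem i) (S i) (H i))),
        (∀ k M σ, |φ k M σ| ≤ 1) →
        ∀ k M σ, |Function.update φ i (untimedMap _ κ) k M σ| ≤ 1 := by
      intro φ κ hφ k M σ
      rcases eq_or_ne k i with rfl | hk
      · rw [Function.update_self]; exact abs_untimedMap_le_one _ M σ
      · rw [Function.update_of_ne hk]; exact hφ k M σ
    -- Deviating to `μ'` in the direct profile has the same outcome as deviating to `ν` in the
    -- original one.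
    have hdev := fun z => G.outcome_directDistribution e π hP (hub δ μ' hδb)
      (ψ := Function.update (fun i => untimedMap (G.decisionProblem i) (μ i)) i
        (untimedMap _ ν)) (by
        intro k M σ
        rcases eq_or_ne k i with rfl | hk
        · simp only [Function.update_self]; exact hν M σ
        · simp only [Function.update_of_ne hk]; exact hδμ k M σ) z
    have h := heq i _ ⟨ν, rfl⟩
    rw [G.pmfExpect_expUtility_sub π i (hub _ ν hφb) hφb] at h
    rw [G.pmfExpect_expUtility_sub _ i (hub _ μ' hδb) hδb]
    simpa only [hdev, hout] using h
  · intro M hM i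
    rw [ExtensiveFormGame.directDistribution, PMF.mem_support_bind_iff] at hM
    obtain ⟨M₀, -, hM⟩ := hM
    rw [PMF.mem_support_map_iff] at hM
    obtain ⟨f, -, rfl⟩ := hM
    exact ⟨_, ⟨_, rfl⟩, rfl⟩
  · rintro i _ ⟨s, rfl⟩
    exact untimedMap_direct (e i) (hH i) s
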